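/- Let $q$ be a prime power, $\mathbb{F}$ a field with $q^2$ elements, $R=\mathbb{F}[X,Y]/\langle Y^q+Y-X^{q+1}\rangle$ the coordinate ring of the affine Hermitian curve $H$, and $P_1,\dots,P_n$ all the rational points of $H$ over $\mathbb{F}$ (so $n=q^3$). For a rational point $P$ of $H$ and $\gamma\in\mathbb{F}$ let $\mathfrak{m}_P=\{f\in R\mid f(P)=0\}$ and $\mathfrak{m}_{(P,\gamma)}=\{f\in R[z]\mid f(P,\gamma)=0\}$; let $v_P(f)$, for $f\in R$, be the largest $r$ with $f\in\mathfrak{m}_P^r$, and let $\mathrm{mult}_{(P,\gamma)}(f)$, for $f\in R[z]$, be the largest $r$ with $f\in\mathfrak{m}_{(P,\gamma)}^r$ (both are $\infty$ for $f=0$). For a matrix $M=[m_{i\gamma}]$ of nonnegative integers, indexed by $1\le i\le n$ and $\gamma\in\mathbb{F}$, and a list $N=[n_i]$ of nonnegative integers, put \[ I_M=\{f\in R[z]\mid \mathrm{mult}_{(P_i,\gamma)}(f)\ge m_{i\gamma}\text{ for all }i,\gamma\},\qquad J_N=\{f\in R\mid v_{P_i}(f)\ge n_i\text{ for all }i\},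 \] and for an integer $l\ge 0$ let $I_{M,l}$ be the $R$-module of all $f\in I_M$ of $z$-degree at most $l$. Fix $M$ and let $l_{\max}=\max_i\sum_{\gamma\in\mathbb{F}}m_{i\gamma}$. Put $M^{(0)}=M$, and for $s\ge 0$ let $N^{(s)}=[n^{(s)}_i]$ with $n^{(s)}_i=\max_\gamma m^{(s)}_{i\gamma}$. For $s=0,1,\dots,l_{\max}-1$ successively: for each $i$ with $n^{(s)}_i>0$ choose any $\gamma^{(s)}_i\in\mathbb{F}$ with $m^{(s)}_{i\gamma^{(s)}_i}=n^{(s)}_i$; let $h^{(s)}\in R$ be any function with $h^{(s)}(P_i)=\gamma^{(s)}_i$ for all such $i$; and obtain $M^{(s+1)}$ from $M^{(s)}$ by decreasing the entry at $(i,\gamma^{(s)}_i)$ by $1$ for each such $i$, leaving all other entries unchanged. For $s\ge l_{\max}$ put $M^{(s+1)}=M^{(s)}$ and $h^{(s)}=0$. Then $J_{N^{(s)}}=R$ for all $s\ge l_{\max}$, and for every integer $l\ge 0$, \[ I_{M,l}=\sum_{s=0}^{l}J_{N^{(s)}}\prod_{0\le r<s}\bigl(z-h^{(r)}\bigr) \]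 as $R$-modules, where $J_{N^{(s)}}\,\pi=\{a\pi\mid a\in J_{N^{(s)}}\}$ for $\pi\in R[z]$. -/

import Mathlib

open Polynomial
open scoped Pointwise

namespace Hermitian

noncomputable section

/-! ### Order of an element along an ideal -/

/-- The largest `r` such that `f ∈ 𝔪 ^ r`, with value `⊤` if `f` lies in all powers of `𝔪`
(in particular for `f = 0`). -/
def ord {A : Type*} [CommRing A] (𝔪 : Ideal A) (f : A) : ℕ∞ :=
  ⨆ r : {r : ℕ // f ∈ 𝔪 ^ r}, ((r : ℕ) : ℕ∞)

theorem natCast_le_ord_iff {A : Type*} [CommRing A] (𝔪 : Ideal A) (f : A) (k : ℕ) :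
    (k : ℕ∞) ≤ ord 𝔪 f ↔ f ∈ 𝔪 ^ k := by
  constructor
  · intro hk
    rcases Nat.eq_zero_or_pos k with rfl | hpos
    · simp
    · have hlt : ((k - 1 : ℕ) : ℕ∞) < ord 𝔪 f :=
        lt_of_lt_of_le (by exact_mod_cast Nat.sub_lt hpos one_pos) hk
      obtain ⟨⟨r, hr⟩, hlt'⟩ := lt_iSup_iff.mp hlt
      have hlt2 : k - 1 < r := by exact_mod_cast hlt'
      exact Ideal.pow_le_pow_right (by omega) hr
  · intro hk
    exact le_iSup (fun r : {r : ℕ // f ∈ 𝔪 ^ r} => ((r : ℕ) : ℕ∞)) ⟨k, hk⟩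

/-! ### The Hermitian curve -/

variable (F : Type*) [Field F] (q : ℕ)

/-- The polynomial `Y ^ q + Y - X ^ (q + 1)`, in `F[X][Y]`. -/
def curvePoly : F[X][X] := X ^ q + X - C (X ^ (q + 1))

/-- The coordinate ring `R = F[X, Y] / ⟨Y ^ q + Y - X ^ (q + 1)⟩`. -/
abbrev CoordRing : Type _ := AdjoinRoot (curvePoly F q)

/-- The rational points `(α, β)` of the affine Hermitian curve. -/
abbrev Point : Type _ := {P : F × F // P.2 ^ q + P.2 = P.1 ^ (q + 1)}

variable {F q}

/-- The value `f(P)` of a function `f ∈ R` at a rational point `P`, as a ring homomorphism. -/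
def evalAt (P : Point F q) : CoordRing F q →+* F :=
  AdjoinRoot.lift (Polynomial.evalRingHom P.1.1) P.1.2 (by
    rw [curvePoly, eval₂_sub, eval₂_C]
    simp [P.2])

/-- The value `f(P, γ)` of a function `f ∈ R[z]` on the surface `H × 𝔸¹`. -/
def evalSurface (P : Point F q) (γ : F) : (CoordRing F q)[X] →+* F :=
  Polynomial.eval₂RingHom (evalAt P) γ

/-- The maximal ideal of `P` in `R`. -/
def maxIdeal (P : Point F q) : Ideal (CoordRing F q) := RingHom.ker (evalAt P)

/-- The maximal ideal of `(P, γ)` in `R[z]`. -/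
def maxIdealSurface (P : Point F q) (γ : F) : Ideal (CoordRing F q)[X] :=
  RingHom.ker (evalSurface P γ)

/-- The valuation `v_P` on `R`. -/
def val (P : Point F q) (f : CoordRing F q) : ℕ∞ := ord (maxIdeal P) f

/-- The multiplicity of `f ∈ R[z]` at the point `(P, γ)`. -/
def mult (P : Point F q) (γ : F) (f : (CoordRing F q)[X]) : ℕ∞ := ord (maxIdealSurface P γ) f

/-! ### The interpolation ideal and related modules -/

/-- `J_N`, the ideal of all `f ∈ R` with `v_P(f) ≥ N P` for every rational point `P`. -/
def idealJ (N : Point F q → ℕ) : Ideal (CoordRing F q) where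
  carrier := {f | ∀ P, (N P : ℕ∞) ≤ val P f}
  zero_mem' _ := (natCast_le_ord_iff _ _ _).2 (zero_mem _)
  add_mem' ha hb P := (natCast_le_ord_iff _ _ _).2
    (add_mem ((natCast_le_ord_iff _ _ _).1 (ha P)) ((natCast_le_ord_iff _ _ _).1 (hb P)))
  smul_mem' c _ ha P := (natCast_le_ord_iff _ _ _).2
    (Ideal.mul_mem_left _ c ((natCast_le_ord_iff _ _ _).1 (ha P)))

/-- `I_M`, the ideal of all `f ∈ R[z]` with multiplicity at least `M P γ` at every `(P, γ)`. -/
def idealI (M : Point F q → F → ℕ) : Ideal (CoordRing F q)[X] where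
  carrier := {f | ∀ P γ, (M P γ : ℕ∞) ≤ mult P γ f}
  zero_mem' _ _ := (natCast_le_ord_iff _ _ _).2 (zero_mem _)
  add_mem' ha hb P γ := (natCast_le_ord_iff _ _ _).2
    (add_mem ((natCast_le_ord_iff _ _ _).1 (ha P γ)) ((natCast_le_ord_iff _ _ _).1 (hb P γ)))
  smul_mem' c _ ha P γ := (natCast_le_ord_iff _ _ _).2
    (Ideal.mul_mem_left _ c ((natCast_le_ord_iff _ _ _).1 (ha P γ)))

/-- `I_{M,l} = I_M ∩ R[z]_l`, where `R[z]_l` consists of the polynomials of `z`-degree at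
most `l`. -/
def moduleI (M : Point F q → F → ℕ) (l : ℕ) :
    Submodule (CoordRing F q) (CoordRing F q)[X] :=
  (idealI M).restrictScalars (CoordRing F q) ⊓ degreeLE (CoordRing F q) (l : WithBot ℕ)

/-! ### The iterated reduction of the multiplicities -/

variable [Fintype F]

/-- The row maxima `n_P = max_γ m_{P,γ}`. -/
def rowMax (M : Point F q → F → ℕ) (P : Point F q) : ℕ :=
  Finset.univ.sup (M P)

variable [DecidableEq F]

/-- `l_max = max_P ∑_γ m_{P,γ}`. -/
def lmax (M : Point F q → F → ℕ) : ℕ :=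
  Finset.univ.sup fun P : Point F q => ∑ γ, M P γ

/-- The matrices `M^{(s)}`, for a choice `g s P` of the position that is decreased in the row of
`P` at step `s`. Rows that are already zero are left unchanged. -/
def reduced (M : Point F q → F → ℕ) (g : ℕ → Point F q → F) : ℕ → Point F q → F → ℕ
  | 0 => M
  | s + 1 => fun P γ =>
      if 0 < rowMax (reduced M g s) P ∧ γ = g s P then reduced M g s P γ - 1
      else reduced M g s P γ

end

end Hermitian

/-! ### Powers of the ideal generated by `𝔪` and the variable -/

namespace Polynomial

variable {A : Type*} [CommRing A]

/-! Divide by the monic `z - h`: `f = (z - h) g + f(h)`. The translation `z ↦ z + h` turns the ideal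
of `(P, h(P))` into `𝔪_P + (z)`, whose powers are described coefficientwise. Hence multiplicity at
least `k` at `(P, h(P))` forces `f(h) ∈ 𝔪_P ^ k`, and multiplication by `z - h` raises the
multiplicity there by exactly one. At the other points over `P`, `z - h` does not vanish and the
multiplicity is unchanged.

Since `h` passes through a maximal entry of every nonzero row, `f ∈ I_M` gives `f(h) ∈ J_N`, while
`J_N ⊆ I_M` always. So `I_{M,l+1} = (z - h) I_{M',l} + J_N` (`IsReduction.moduleI_succ`), and the
formula follows by induction on `l`. Each step lowers every nonzero row sum by one, so after `l_max`
steps the matrix is zero. -/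

theorem coeff_mem_of_mem_pow_map_C_sup_span_X (𝔪 : Ideal A) (k : ℕ) {f : A[X]}
    (hf : f ∈ (𝔪.map C ⊔ Ideal.span {X}) ^ k) (j : ℕ) : f.coeff j ∈ 𝔪 ^ (k - j) := by
  induction k generalizing f j with
  | zero => simp
  | succ k ih =>
    rw [pow_succ'] at hf
    refine Submodule.mul_induction_on hf (fun a ha b hb => ?_) (fun a b ha hb => ?_)
    · obtain ⟨c, hc, d, hd, rfl⟩ := Submodule.mem_sup.1 ha
      obtain ⟨e, rfl⟩ := Ideal.mem_span_singleton'.1 hd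
      rw [Ideal.mem_map_C_iff] at hc
      rw [add_mul, coeff_add]
      refine add_mem ?_ ?_
      · rw [coeff_mul]
        refine sum_mem fun x hx => ?_
        have hx' := Finset.HasAntidiagonal.mem_antidiagonal.1 hx
        have hmul : c.coeff x.1 * b.coeff x.2 ∈ 𝔪 ^ (k - x.2 + 1) := by
          rw [pow_succ']
          exact Ideal.mul_mem_mul (hc _) (ih hb _)
        exact Ideal.pow_le_pow_right (by omega) hmul
      -- The factor `e` is absorbed into `b`, and `X` shifts the index by one, matching `k + 1 - (j
      -- + 1) = k - j`.
      · rw [mul_right_comm]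
        cases j with
        | zero => simp
        | succ j =>
          rw [coeff_mul_X, Nat.add_sub_add_right]
          exact ih (Ideal.mul_mem_left _ e hb) j
    · rw [coeff_add]
      exact add_mem ha hb

theorem mem_pow_map_C_sup_span_X_iff (𝔪 : Ideal A) (k : ℕ) (f : A[X]) :
    f ∈ (𝔪.map C ⊔ Ideal.span {X}) ^ k ↔ ∀ j, f.coeff j ∈ 𝔪 ^ (k - j) := by
  refine ⟨coeff_mem_of_mem_pow_map_C_sup_span_X 𝔪 k, fun hf => ?_⟩
  rw [f.as_sum_range_C_mul_X_pow]
  refine sum_mem fun j _ => ?_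
  have hC : C (f.coeff j) ∈ (𝔪.map C ⊔ Ideal.span {X}) ^ (k - j) := by
    refine Ideal.pow_right_mono le_sup_left _ ?_
    rw [← Ideal.map_pow]
    exact Ideal.mem_map_of_mem C (hf j)
  have hX : (X : A[X]) ^ j ∈ (𝔪.map C ⊔ Ideal.span {X}) ^ j :=
    Ideal.pow_mem_pow (Ideal.mem_sup_right (Ideal.mem_span_singleton_self X)) j
  have := Ideal.mul_mem_mul hC hX
  rw [← pow_add] at this
  exact Ideal.pow_le_pow_right (by omega) this

end Polynomial

namespace Hermitian

/-! ### Multiplicities at points of the surface -/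

section Multiplicity

variable {F : Type*} [Field F] {q : ℕ}

theorem evalSurface_evalAt (P : Point F q) (h : CoordRing F q) (f : (CoordRing F q)[X]) :
    evalSurface P (evalAt P h) f = evalAt P (f.eval h) := by
  change eval₂ (evalAt P) (evalAt P h) f = _
  rw [eval₂_at_apply]

theorem evalSurface_C (P : Point F q) (γ : F) (a : CoordRing F q) :
    evalSurface P γ (C a) = evalAt P a :=
  eval₂_C _ _

theorem evalSurface_X_sub_C (P : Point F q) (γ : F) (h : CoordRing F q) :
    evalSurface P γ (X - C h) = γ - evalAt P h := by
  rw [map_sub, evalSurface_C]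
  exact congrArg (· - _) (eval₂_X _ _)

/-- Only the constant Taylor coefficient `f(h)` is constrained, and its value at `P` is `f(P,
h(P))`. -/
theorem comap_taylor_maxIdealSurface (P : Point F q) (h : CoordRing F q) :
    ((maxIdeal P).map C ⊔ Ideal.span {X}).comap (taylorEquiv h : _ ≃+* (CoordRing F q)[X]) =
      maxIdealSurface P (evalAt P h) := by
  ext f
  have key := mem_pow_map_C_sup_span_X_iff (maxIdeal P) 1 (taylor h f)
  rw [pow_one] at key
  rw [Ideal.mem_comap]
  refine key.trans ⟨fun hf => ?_, fun hf j => ?_⟩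
  · have h0 := hf 0
    rw [taylor_coeff_zero, Nat.sub_zero, pow_one] at h0
    exact (evalSurface_evalAt P h f).trans h0
  · cases j with
    | zero =>
      rw [taylor_coeff_zero, Nat.sub_zero, pow_one]
      exact (evalSurface_evalAt P h f).symm.trans hf
    | succ j => simp

/-- Expanding `f` in powers of `z - h` describes the multiplicity at `(P, h(P))`. -/
theorem mem_maxIdealSurface_pow_iff (P : Point F q) (h : CoordRing F q) (k : ℕ)
    (f : (CoordRing F q)[X]) :
    f ∈ maxIdealSurface P (evalAt P h) ^ k ↔
      ∀ j, (taylor h f).coeff j ∈ maxIdeal P ^ (k - j) := by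
  rw [← mem_pow_map_C_sup_span_X_iff, ← comap_taylor_maxIdealSurface,
    ← Ideal.map_symm, ← Ideal.map_pow, Ideal.map_symm, Ideal.mem_comap]
  rfl

theorem eval_mem_maxIdeal_pow {P : Point F q} {h : CoordRing F q} {k : ℕ}
    {f : (CoordRing F q)[X]} (hf : f ∈ maxIdealSurface P (evalAt P h) ^ k) :
    f.eval h ∈ maxIdeal P ^ k := by
  have := (mem_maxIdealSurface_pow_iff P h k f).1 hf 0
  rwa [taylor_coeff_zero, Nat.sub_zero] at this

/-- In the expansion around `h`, multiplying by `z - h` just shifts the coefficients by one place.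
-/
theorem X_sub_C_mul_mem_maxIdealSurface_pow_succ_iff (P : Point F q) (h : CoordRing F q) (k : ℕ)
    (f : (CoordRing F q)[X]) :
    (X - C h) * f ∈ maxIdealSurface P (evalAt P h) ^ (k + 1) ↔
      f ∈ maxIdealSurface P (evalAt P h) ^ k := by
  have hX : taylor h ((X - C h) * f) = taylor h f * X := by
    rw [taylor_mul, map_sub, taylor_X, taylor_C, add_sub_cancel_right, mul_comm]
  rw [mem_maxIdealSurface_pow_iff, mem_maxIdealSurface_pow_iff, hX]
  refine ⟨fun hf j => ?_, fun hf j => ?_⟩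
  · have := hf (j + 1)
    rwa [coeff_mul_X, Nat.add_sub_add_right] at this
  · cases j with
    | zero => simp
    | succ j =>
      rw [coeff_mul_X, Nat.add_sub_add_right]
      exact hf j

theorem C_mem_maxIdealSurface_pow {P : Point F q} (γ : F) {k : ℕ} {a : CoordRing F q}
    (ha : a ∈ maxIdeal P ^ k) : C a ∈ maxIdealSurface P γ ^ k := by
  have hle : (maxIdeal P).map C ≤ maxIdealSurface P γ :=
    Ideal.map_le_iff_le_comap.2 fun a ha => (evalSurface_C P γ a).trans ha
  refine Ideal.pow_right_mono hle k ?_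
  rw [← Ideal.map_pow]
  exact Ideal.mem_map_of_mem C ha

theorem evalSurface_surjective (P : Point F q) (γ : F) :
    Function.Surjective (evalSurface P γ) := fun c =>
  ⟨C (AdjoinRoot.of _ (C c)), by
    rw [evalSurface_C]
    simp [evalAt]⟩

instance maxIdealSurface_isMaximal (P : Point F q) (γ : F) : (maxIdealSurface P γ).IsMaximal :=
  RingHom.ker_isMaximal_of_surjective _ (evalSurface_surjective P γ)

/-- Powers of a maximal ideal are primary, so a factor not vanishing at the point can be cancelled.
-/
theorem mem_maxIdealSurface_pow_of_X_sub_C_mul_mem {P : Point F q} {γ : F} {h : CoordRing F q}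
    {k : ℕ} {f : (CoordRing F q)[X]} (hne : γ ≠ evalAt P h)
    (hf : (X - C h) * f ∈ maxIdealSurface P γ ^ k) : f ∈ maxIdealSurface P γ ^ k := by
  refine (Ideal.IsMaximal.mul_mem_pow _ hf).resolve_left fun hX => hne ?_
  have h0 : evalSurface P γ (X - C h) = 0 := hX
  rwa [evalSurface_X_sub_C, sub_eq_zero] at h0

theorem mem_idealI_iff {M : Point F q → F → ℕ} {f : (CoordRing F q)[X]} :
    f ∈ idealI M ↔ ∀ P γ, f ∈ maxIdealSurface P γ ^ M P γ :=
  forall₂_congr fun _ _ => natCast_le_ord_iff _ _ _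

theorem mem_idealJ_iff {N : Point F q → ℕ} {a : CoordRing F q} :
    a ∈ idealJ N ↔ ∀ P, a ∈ maxIdeal P ^ N P :=
  forall_congr' fun _ => natCast_le_ord_iff _ _ _

theorem mem_moduleI_iff {M : Point F q → F → ℕ} {l : ℕ} {f : (CoordRing F q)[X]} :
    f ∈ moduleI M l ↔ f ∈ idealI M ∧ f.natDegree ≤ l := by
  rw [natDegree_le_iff_degree_le, ← mem_degreeLE]
  exact Iff.rfl

theorem idealJ_zero : idealJ (0 : Point F q → ℕ) = ⊤ := by
  ext a
  simp [mem_idealJ_iff]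

end Multiplicity

/-! ### One reduction step and the recursion for `I_{M,l}` -/

section Reduction

variable {F : Type*} [Field F] [Fintype F] {q : ℕ}

theorem le_rowMax (M : Point F q → F → ℕ) (P : Point F q) (γ : F) : M P γ ≤ rowMax M P :=
  Finset.le_sup (f := M P) (Finset.mem_univ γ)

theorem rowMax_eq_zero_iff {M : Point F q → F → ℕ} {P : Point F q} :
    rowMax M P = 0 ↔ ∀ γ, M P γ = 0 := by
  rw [rowMax, ← bot_eq_zero, Finset.sup_eq_bot_iff]
  exact ⟨fun hM γ => hM γ (Finset.mem_univ γ), fun hM γ _ => hM γ⟩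

/-- `M'` arises from `M` by decreasing, in each nonzero row `P`, the maximal entry at `h(P)`. -/
def IsReduction (M M' : Point F q → F → ℕ) (h : CoordRing F q) : Prop :=
  ∀ P, (rowMax M P = 0 ∧ ∀ γ, M' P γ = 0) ∨
    (M P (evalAt P h) = rowMax M P ∧ M P (evalAt P h) = M' P (evalAt P h) + 1 ∧
      ∀ γ, γ ≠ evalAt P h → M' P γ = M P γ)

variable {M M' : Point F q → F → ℕ} {h : CoordRing F q}

theorem C_mem_idealI {a : CoordRing F q} (ha : a ∈ idealJ (rowMax M)) : C a ∈ idealI M :=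
  mem_idealI_iff.2 fun P γ => Ideal.pow_le_pow_right (le_rowMax M P γ)
    (C_mem_maxIdealSurface_pow γ (mem_idealJ_iff.1 ha P))

namespace IsReduction

theorem X_sub_C_mul_mem_idealI_iff (hr : IsReduction M M' h) (f : (CoordRing F q)[X]) :
    (X - C h) * f ∈ idealI M ↔ f ∈ idealI M' := by
  rw [mem_idealI_iff, mem_idealI_iff]
  refine forall_congr' fun P => ?_
  rcases hr P with ⟨h0, h0'⟩ | ⟨-, hdec, heq⟩
  · have h1 : ∀ γ, M P γ = 0 := fun γ => Nat.eq_zero_of_le_zero (h0 ▸ le_rowMax M P γ)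
    simp [h0', h1]
  · refine forall_congr' fun γ => ?_
    by_cases hγ : γ = evalAt P h
    · rw [hγ, hdec, X_sub_C_mul_mem_maxIdealSurface_pow_succ_iff]
    · rw [heq γ hγ]
      exact ⟨mem_maxIdealSurface_pow_of_X_sub_C_mul_mem hγ, Ideal.mul_mem_left _ _⟩

/-- This is where maximality of the chosen entry is needed: evaluation at `h` retains only the
multiplicity at `(P, h(P))`. -/
theorem eval_mem_idealJ (hr : IsReduction M M' h) {f : (CoordRing F q)[X]} (hf : f ∈ idealI M) :
    f.eval h ∈ idealJ (rowMax M) := by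
  rw [mem_idealI_iff] at hf
  refine mem_idealJ_iff.2 fun P => ?_
  rcases hr P with ⟨h0, -⟩ | ⟨hmax, -, -⟩
  · simp [h0]
  · rw [← hmax]
    exact eval_mem_maxIdeal_pow (hf P _)

theorem moduleI_zero (hr : IsReduction M M' h) :
    moduleI M 0 = idealJ (rowMax M) • Submodule.span (CoordRing F q) {1} := by
  ext f
  rw [mem_moduleI_iff, Submodule.mem_smul_span_singleton]
  constructor
  · rintro ⟨hf, hdeg⟩
    rw [natDegree_eq_zero.1 (Nat.eq_zero_of_le_zero hdeg) |>.choose_spec.symm] at hf ⊢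
    have := hr.eval_mem_idealJ hf
    rw [eval_C] at this
    exact ⟨_, this, by rw [smul_eq_C_mul, mul_one]⟩
  · rintro ⟨a, ha, rfl⟩
    rw [smul_eq_C_mul, mul_one]
    exact ⟨C_mem_idealI ha, (natDegree_C a).le⟩

theorem moduleI_succ (hr : IsReduction M M' h) (l : ℕ) :
    moduleI M (l + 1) = (moduleI M' l).map (LinearMap.mulLeft (CoordRing F q) (X - C h)) +
      idealJ (rowMax M) • Submodule.span (CoordRing F q) {1} := by
  ext f
  rw [Submodule.add_eq_sup, Submodule.mem_sup]
  constructor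
  · intro hf
    obtain ⟨hf, hdeg⟩ := mem_moduleI_iff.1 hf
    have ha := hr.eval_mem_idealJ hf
    have hdiv := modByMonic_add_div f (X - C h)
    rw [modByMonic_X_sub_C_eq_C_eval, add_comm] at hdiv
    refine ⟨_, Submodule.mem_map_of_mem (r := f /ₘ (X - C h))
      (mem_moduleI_iff.2 ⟨?_, ?_⟩), _, Submodule.mem_smul_span_singleton.2 ⟨_, ha, rfl⟩, ?_⟩
    · rw [← hr.X_sub_C_mul_mem_idealI_iff, eq_sub_of_add_eq hdiv]
      exact sub_mem hf (C_mem_idealI ha)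
    -- Over a nontrivial ring `X - C h` has degree exactly one, so the quotient loses one degree.
    · nontriviality (CoordRing F q)
      rw [natDegree_divByMonic _ (monic_X_sub_C h), natDegree_X_sub_C]
      omega
    · rwa [smul_eq_C_mul, mul_one, LinearMap.mulLeft_apply]
  · rintro ⟨_, ⟨f, hf, rfl⟩, _, hmem, rfl⟩
    obtain ⟨a, ha, rfl⟩ := Submodule.mem_smul_span_singleton.1 hmem
    obtain ⟨hf, hdeg⟩ := mem_moduleI_iff.1 hf
    rw [smul_eq_C_mul, mul_one, LinearMap.mulLeft_apply]
    refine add_mem (mem_moduleI_iff.2 ⟨(hr.X_sub_C_mul_mem_idealI_iff f).2 hf, ?_⟩)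
      (mem_moduleI_iff.2 ⟨C_mem_idealI ha, (natDegree_C a).trans_le (Nat.zero_le _)⟩)
    have := natDegree_X_sub_C_le h
    exact natDegree_mul_le.trans (by omega)

end IsReduction

theorem moduleI_eq_sum {Ms : ℕ → Point F q → F → ℕ} {h : ℕ → CoordRing F q}
    (hr : ∀ s, IsReduction (Ms s) (Ms (s + 1)) (h s)) (l : ℕ) :
    moduleI (Ms 0) l = ∑ s ∈ Finset.range (l + 1), idealJ (rowMax (Ms s)) •
      Submodule.span (CoordRing F q) {∏ r ∈ Finset.range s, (X - C (h r))} := by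
  induction l generalizing Ms h with
  | zero => simpa using (hr 0).moduleI_zero
  | succ l ih =>
    have hmap : ∀ (t : Finset ℕ) (S : ℕ → Submodule (CoordRing F q) (CoordRing F q)[X])
        (φ : (CoordRing F q)[X] →ₗ[CoordRing F q] (CoordRing F q)[X]),
        (∑ s ∈ t, S s).map φ = ∑ s ∈ t, (S s).map φ := fun t S φ => by
      induction t using Finset.cons_induction with
      | empty => simp
      | cons a t ha iht => rw [Finset.sum_cons, Finset.sum_cons, ← iht, Submodule.add_eq_sup,
          Submodule.add_eq_sup, Submodule.map_sup]
    -- The induction hypothesis is applied to the sequences shifted by one; multiplication by `X - C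
    -- (h 0)` restores the missing factor, and the remaining summand is the term `s = 0`.
    rw [(hr 0).moduleI_succ, ih (Ms := fun s => Ms (s + 1)) (h := fun s => h (s + 1))
      fun s => hr (s + 1), hmap, Finset.sum_range_succ' _ (l + 1), Finset.prod_range_zero]
    refine congrArg (· + _) (Finset.sum_congr rfl fun s _ => ?_)
    rw [Submodule.map_smul'', Submodule.map_span, Set.image_singleton, LinearMap.mulLeft_apply,
      Finset.prod_range_succ', mul_comm]

/-! ### Termination of the reduction -/

variable [DecidableEq F]

theorem reduced_succ_of_rowMax_eq_zero {M : Point F q → F → ℕ} {g : ℕ → Point F q → F} {s : ℕ}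
    {P : Point F q} (h0 : rowMax (reduced M g s) P = 0) (γ : F) :
    reduced M g (s + 1) P γ = 0 := by
  have := le_rowMax (reduced M g s) P γ
  simp only [reduced, h0, lt_irrefl, false_and, if_false]
  omega

theorem sum_reduced_le {M : Point F q → F → ℕ} {g : ℕ → Point F q → F}
    (hg : ∀ s < lmax M, ∀ P, 0 < rowMax (reduced M g s) P →
      reduced M g s P (g s P) = rowMax (reduced M g s) P)
    {s : ℕ} (hs : s ≤ lmax M) (P : Point F q) : ∑ γ, reduced M g s P γ ≤ lmax M - s := by
  induction s with
  | zero => exact Finset.le_sup (f := fun P : Point F q => ∑ γ, M P γ) (Finset.mem_univ P)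
  | succ s ih =>
    rcases Nat.eq_zero_or_pos (rowMax (reduced M g s) P) with h0 | hpos
    · simp [reduced_succ_of_rowMax_eq_zero h0]
    · have hlt : ∑ γ, reduced M g (s + 1) P γ < ∑ γ, reduced M g s P γ := by
        refine Finset.sum_lt_sum (fun γ _ => ?_) ⟨g s P, Finset.mem_univ _, ?_⟩
        · simp only [reduced]
          split_ifs <;> omega
        -- The chosen entry equals the positive row maximum, so the truncated subtraction really
        -- decreases it.
        · have := hg s (by omega) P hpos
          simp only [reduced, hpos, and_self, if_true]
          omega
      have := ih (by omega)
      omega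

theorem rowMax_reduced_eq_zero {M : Point F q → F → ℕ} {g : ℕ → Point F q → F}
    (hg : ∀ s < lmax M, ∀ P, 0 < rowMax (reduced M g s) P →
      reduced M g s P (g s P) = rowMax (reduced M g s) P)
    {s : ℕ} (hs : lmax M ≤ s) : rowMax (reduced M g s) = 0 := by
  induction s, hs using Nat.le_induction with
  | base =>
    ext P
    have := sum_reduced_le hg le_rfl P
    rw [Nat.sub_self, Nat.le_zero, Finset.sum_eq_zero_iff] at this
    exact rowMax_eq_zero_iff.2 fun γ => this γ (Finset.mem_univ γ)
  | succ s _ ih =>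
    ext P
    exact rowMax_eq_zero_iff.2 (reduced_succ_of_rowMax_eq_zero (congrFun ih P))

theorem isReduction_reduced {M : Point F q → F → ℕ} {g : ℕ → Point F q → F} {s : ℕ}
    {h : CoordRing F q}
    (hg : ∀ P, 0 < rowMax (reduced M g s) P →
      reduced M g s P (g s P) = rowMax (reduced M g s) P)
    (hh : ∀ P, 0 < rowMax (reduced M g s) P → evalAt P h = g s P) :
    IsReduction (reduced M g s) (reduced M g (s + 1)) h := by
  intro P
  rcases Nat.eq_zero_or_pos (rowMax (reduced M g s) P) with h0 | hpos
  · exact Or.inl ⟨h0, reduced_succ_of_rowMax_eq_zero h0⟩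
  · have hmax := hg P hpos
    rw [hh P hpos]
    refine Or.inr ⟨hmax, ?_, fun γ hγ => ?_⟩
    · simp only [reduced, hpos, and_self, if_true]
      omega
    · simp only [reduced, hγ, and_false, if_false]

end Reduction

end Hermitian

theorem mainTheorem3 (q : ℕ) (hq : IsPrimePow q)
    (F : Type*) [Field F] [Fintype F] [DecidableEq F] (hF : Fintype.card F = q ^ 2)
    -- the multiplicity matrix
    (M : Hermitian.Point F q → F → ℕ)
    -- the choices `γ_P` at each step `s`: a position of a maximal entry in each nonzero row
    (g : ℕ → Hermitian.Point F q → F)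
    (hg : ∀ s < Hermitian.lmax M, ∀ P, 0 < Hermitian.rowMax (Hermitian.reduced M g s) P →
      Hermitian.reduced M g s P (g s P) = Hermitian.rowMax (Hermitian.reduced M g s) P)
    -- the functions `h^{(s)}`
    (h : ℕ → Hermitian.CoordRing F q)
    (hh : ∀ s < Hermitian.lmax M, ∀ P, 0 < Hermitian.rowMax (Hermitian.reduced M g s) P →
      Hermitian.evalAt P (h s) = g s P)
    (hh0 : ∀ s, Hermitian.lmax M ≤ s → h s = 0) :
    (∀ s, Hermitian.lmax M ≤ s →
      Hermitian.idealJ (Hermitian.rowMax (Hermitian.reduced M g s)) = ⊤) ∧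
    ∀ l : ℕ, Hermitian.moduleI M l =
      ∑ s ∈ Finset.range (l + 1),
        Hermitian.idealJ (Hermitian.rowMax (Hermitian.reduced M g s)) •
          Submodule.span (Hermitian.CoordRing F q)
            {∏ r ∈ Finset.range s, (X - C (h r))} := by
  have hzero : ∀ s, Hermitian.lmax M ≤ s →
      Hermitian.rowMax (Hermitian.reduced M g s) = 0 := fun s hs =>
    Hermitian.rowMax_reduced_eq_zero hg hs
  refine ⟨fun s hs => (hzero s hs).symm ▸ Hermitian.idealJ_zero, fun l =>
    Hermitian.moduleI_eq_sum (Ms := Hermitian.reduced M g) (fun s => ?_) l⟩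
  rcases lt_or_ge s (Hermitian.lmax M) with hs | hs
  · exact Hermitian.isReduction_reduced (hg s hs) (hh s hs)
  -- From `l_max` on every row is zero, so the conditions on `g` and `h` hold vacuously.
  · have h0 : ∀ P, ¬ 0 < Hermitian.rowMax (Hermitian.reduced M g s) P := fun P => by
      simp [hzero s hs]
    exact Hermitian.isReduction_reduced (fun P hP => absurd hP (h0 P))
      fun P hP => absurd hP (h0 P)
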